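/- Let $\mathbb H=\{s\in\mathbb C:\operatorname{Re}s>-\tfrac12\}$, so that for every $s\in\mathbb H$ the function $x^s$ belongs to $L^2[0,1]$ (complex-valued, Lebesgue measure), and let $c,\beta:\mathbb H\to\mathbb C$ be arbitrary functions. Say that a bounded linear operator $T$ on $L^2[0,1]$ is *given by* $x^s\mapsto c(s)\,x^{\beta(s)}$ if $T(x^s)=c(s)\,x^{\beta(s)}$ (almost everywhere on $[0,1]$) for every $s\in\mathbb H$. Consider the condition: $(\ast)$ $\beta$ is an automorphism of $\mathbb H$ (a holomorphic bijection of $\mathbb H$ onto itself with holomorphic inverse), and there is a real number $\theta$ such that $$c(s)=\frac{e^{i\theta}}{\sqrt{1+2\operatorname{Re}\beta(0)}}\;\frac{1+\overline{\beta(0)}+\beta(s)}{1+s}\qquad\text{for all } s\in\mathbb H .$$ Then the formula $x^s\mapsto c(s)\,x^{\beta(s)}$ defines a unitary operator on $L^2[0,1]$ if and only if $(\ast)$ holds. That is, there exists a unitary operator on $L^2[0,1]$ given by $x^s\mapsto c(s)\,x^{\beta(s)}$ if and only if $(\ast)$ holds; and any bounded linear operator on $L^2[0,1]$ given by $x^s\mapsto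 c(s)\,x^{\beta(s)}$ is unitary if and only if $(\ast)$ holds. -/

import Mathlib

open MeasureTheory Set

noncomputable section

/-- The open half-plane of complex numbers with real part greater than `-1/2`. -/
def halfPlane : Set ℂ := {s : ℂ | -(1 / 2 : ℝ) < s.re}

/-- Lebesgue measure on the interval `[0, 1]`. -/
abbrev unitIntervalMeasure : Measure ℝ := volume.restrict (Icc (0 : ℝ) 1)

/-- The complex Hilbert space `L²[0,1]`. -/
abbrev L2Unit : Type := Lp ℂ 2 unitIntervalMeasure

/-- The function `x ↦ x ^ s`, for a complex exponent `s`. -/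
def monomialFun (s : ℂ) : ℝ → ℂ := fun x => (x : ℂ) ^ s

/-- For `s` in the half-plane, the function `x ^ s` is square integrable on `[0,1]`. -/
theorem memLp_monomialFun {s : ℂ} (hs : s ∈ halfPlane) :
    MemLp (monomialFun s) 2 unitIntervalMeasure := by
  have hs' : -(1 / 2 : ℝ) < s.re := hs
  have hmeas : Measurable (monomialFun s) := by
    unfold monomialFun
    fun_prop
  rw [memLp_two_iff_integrable_sq_norm hmeas.aestronglyMeasurable]
  have h1 : IntervalIntegrable (fun x : ℝ => x ^ (2 * s.re)) volume 0 1 :=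
    intervalIntegral.intervalIntegrable_rpow' (by linarith)
  rw [intervalIntegrable_iff_integrableOn_Ioc_of_le zero_le_one] at h1
  change IntegrableOn (fun x => ‖monomialFun s x‖ ^ 2) (Icc 0 1) volume
  rw [integrableOn_Icc_iff_integrableOn_Ioc]
  refine h1.congr_fun (fun x hx => ?_) measurableSet_Ioc
  have hx0 : 0 < x := hx.1
  simp only [monomialFun]
  rw [Complex.norm_cpow_eq_rpow_re_of_pos hx0, mul_comm, Real.rpow_mul hx0.le]
  norm_num

/-- The monomial `x ^ s` as an element of `L²[0,1]`, for `s` in the half-plane. -/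
def monomialL2 (s : ℂ) (hs : s ∈ halfPlane) : L2Unit :=
  (memLp_monomialFun hs).toLp (monomialFun s)

/-- The bounded operator `T` on `L²[0,1]` acts by `T : x ^ s ↦ c(s) x ^ β(s)`, for every `s` in
the half-plane (equality of functions almost everywhere on `[0,1]`). -/
def ActsOnMonomials (T : L2Unit →L[ℂ] L2Unit) (c β : ℂ → ℂ) : Prop :=
  ∀ (s : ℂ) (hs : s ∈ halfPlane),
    (T (monomialL2 s hs) : ℝ → ℂ) =ᵐ[unitIntervalMeasure] fun x => c s * monomialFun (β s) x

/-- `β` restricts to an automorphism of the half-plane: a holomorphic self-map with a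
holomorphic inverse. -/
def IsHalfPlaneAutomorphism (β : ℂ → ℂ) : Prop :=
  DifferentiableOn ℂ β halfPlane ∧ MapsTo β halfPlane halfPlane ∧
    ∃ γ : ℂ → ℂ, DifferentiableOn ℂ γ halfPlane ∧ MapsTo γ halfPlane halfPlane ∧
      InvOn γ β halfPlane halfPlane

/-- The formula for the multiplier: for some real `θ` and every `s` in the half-plane,
`c(s) = (exp(iθ) / √(1 + 2 Re β(0))) * (1 + conj (β(0)) + β(s)) / (1 + s)`. -/
def IsUnitaryMultiplier (c β : ℂ → ℂ) : Prop :=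
  ∃ θ : ℝ, ∀ s ∈ halfPlane,
    c s = Complex.exp (θ * Complex.I) / (Real.sqrt (1 + 2 * (β 0).re) : ℂ) *
      ((1 + (starRingEnd ℂ) (β 0) + β s) / (1 + s))

end

/-!
The Gram matrix of the monomials `x ^ s` is the kernel `(1 + conj s + t)⁻¹`, and the monomials span
a dense subspace (Weierstrass). So an isometry given by `x ^ s ↦ c s • x ^ β s` preserves this Gram
matrix, and conversely preservation of the Gram matrix together with surjectivity of `β` produces a
unitary.

Row `0` of the Gram identity determines `c` up to a phase, which is the formula for the multiplier.
Let `φ b` be the Möbius map of the half-plane onto the unit disc with `φ b b = 0`. Since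
`1 - conj (φ b s) * φ b t` is `1 + conj s + t` up to a factor of rank one, the formula for `c` turns
the Gram identity into `conj (φ b (β s)) * φ b (β t) = conj (φ 0 s) * φ 0 t` with `b = β 0`. Kernels
of rank one agree exactly when the functions agree up to a phase, so this says that `φ b ∘ β` is a
rotation of `φ 0`, and by the Schwarz lemma the maps `β` of this form are exactly the automorphisms.
-/

open ComplexConjugate

section HilbertSpace

theorem denseRange_linearCombination {ι R M : Type*} [Semiring R] [AddCommMonoid M] [Module R M]
    [TopologicalSpace M] {v : ι → M} (hv : Dense (Submodule.span R (range v) : Set M)) :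
    DenseRange (Finsupp.linearCombination R v) := by
  rwa [DenseRange, ← LinearMap.coe_range, Finsupp.range_linearCombination]

variable {ι 𝕜 E F : Type*} [RCLike 𝕜] [NormedAddCommGroup E] [InnerProductSpace 𝕜 E]
  [NormedAddCommGroup F] [InnerProductSpace 𝕜 F]

theorem norm_linearCombination_eq_of_inner_eq {u : ι → E} {v : ι → F}
    (h : ∀ i j, inner 𝕜 (v i) (v j) = inner 𝕜 (u i) (u j)) (a : ι →₀ 𝕜) :
    ‖Finsupp.linearCombination 𝕜 v a‖ = ‖Finsupp.linearCombination 𝕜 u a‖ := by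
  simp only [norm_eq_sqrt_re_inner (𝕜 := 𝕜), Finsupp.linearCombination_apply, Finsupp.sum,
    sum_inner, inner_sum, inner_smul_left, inner_smul_right, h]

theorem exists_linearIsometryEquiv_of_inner_eq [CompleteSpace E] [CompleteSpace F]
    {u : ι → E} {v : ι → F} (hu : Dense (Submodule.span 𝕜 (range u) : Set E))
    (hv : Dense (Submodule.span 𝕜 (range v) : Set F))
    (h : ∀ i j, inner 𝕜 (v i) (v j) = inner 𝕜 (u i) (u j)) :
    ∃ e : E ≃ₗᵢ[𝕜] F, ∀ i, e (u i) = v i := by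
  refine ⟨(LinearEquiv.refl 𝕜 (ι →₀ 𝕜)).extendOfIsometry _ _ (denseRange_linearCombination hu)
    (denseRange_linearCombination hv) (norm_linearCombination_eq_of_inner_eq h), fun i => ?_⟩
  simpa only [LinearEquiv.refl_apply, Finsupp.linearCombination_single, one_smul] using
    LinearEquiv.extendOfIsometry_eq (LinearEquiv.refl 𝕜 (ι →₀ 𝕜)) _ _
      (denseRange_linearCombination hu) (denseRange_linearCombination hv)
      (norm_linearCombination_eq_of_inner_eq h) (Finsupp.single i 1)

theorem exists_norm_eq_one_forall_eq_mul_iff {α : Type*} {S : Set α} {f g : α → 𝕜} :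
    (∃ l : 𝕜, ‖l‖ = 1 ∧ ∀ s ∈ S, f s = l * g s) ↔
      ∀ s ∈ S, ∀ t ∈ S, conj (f s) * f t = conj (g s) * g t := by
  constructor
  · rintro ⟨l, hl, hfg⟩ s hs t ht
    rw [hfg s hs, hfg t ht, map_mul, mul_mul_mul_comm, RCLike.conj_mul, hl]
    simp only [RCLike.ofReal_one, one_pow, one_mul]
  intro h
  have hnorm : ∀ s ∈ S, ‖f s‖ = ‖g s‖ := fun s hs => by
    have hsq := h s hs s hs
    rw [RCLike.conj_mul, RCLike.conj_mul] at hsq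
    exact (sq_eq_sq₀ (norm_nonneg _) (norm_nonneg _)).1 (by exact_mod_cast hsq)
  by_cases hg : ∀ s ∈ S, g s = 0
  · exact ⟨1, norm_one, fun s hs => by
      rw [hg s hs, mul_zero, ← norm_eq_zero, hnorm s hs, hg s hs, norm_zero]⟩
  push Not at hg
  obtain ⟨s, hs, hgs⟩ := hg
  have hfs : conj (f s) ≠ 0 := by
    rw [Ne, map_eq_zero, ← norm_eq_zero, hnorm s hs, norm_eq_zero]
    exact hgs
  refine ⟨conj (g s) / conj (f s), ?_, fun t ht => ?_⟩
  · rw [norm_div, RCLike.norm_conj, RCLike.norm_conj, hnorm s hs, div_self (norm_ne_zero_iff.2 hgs)]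
  · rw [div_mul_eq_mul_div, eq_div_iff hfs, ← h s hs t ht, mul_comm]

end HilbertSpace

section PolynomialDensity

variable {𝕜 : Type*} [RCLike 𝕜] {a b : ℝ}

theorem exists_rclike_polynomial_near_of_continuousOn {f : ℝ → 𝕜} (hf : ContinuousOn f (Icc a b))
    {ε : ℝ} (hε : 0 < ε) :
    ∃ P : Polynomial 𝕜, ∀ x ∈ Icc a b, ‖P.eval (x : 𝕜) - f x‖ < ε := by
  obtain ⟨P, hP⟩ := exists_polynomial_near_of_continuousOn a b (fun x => RCLike.re (f x))
    (RCLike.continuous_re.comp_continuousOn hf) (ε / 2) (half_pos hε)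
  obtain ⟨Q, hQ⟩ := exists_polynomial_near_of_continuousOn a b (fun x => RCLike.im (f x))
    (RCLike.continuous_im.comp_continuousOn hf) (ε / 2) (half_pos hε)
  refine ⟨P.map (algebraMap ℝ 𝕜) + Polynomial.C RCLike.I * Q.map (algebraMap ℝ 𝕜),
    fun x hx => ?_⟩
  have heval (R : Polynomial ℝ) : (R.map (algebraMap ℝ 𝕜)).eval (x : 𝕜) = (R.eval x : ℝ) :=
    Polynomial.eval_map_apply (algebraMap ℝ 𝕜) x
  have hsplit : (P.map (algebraMap ℝ 𝕜) + Polynomial.C RCLike.I * Q.map (algebraMap ℝ 𝕜)).eval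
        (x : 𝕜) - f x =
      ((P.eval x - RCLike.re (f x) : ℝ) : 𝕜) +
        RCLike.I * ((Q.eval x - RCLike.im (f x) : ℝ) : 𝕜) := by
    rw [Polynomial.eval_add, Polynomial.eval_mul, Polynomial.eval_C, heval, heval]
    conv_lhs => rw [← RCLike.re_add_im (f x)]
    push_cast
    ring
  calc ‖(P.map (algebraMap ℝ 𝕜) + Polynomial.C RCLike.I * Q.map (algebraMap ℝ 𝕜)).eval
        (x : 𝕜) - f x‖
      ≤ |P.eval x - RCLike.re (f x)| + 1 * |Q.eval x - RCLike.im (f x)| := by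
        rw [hsplit]
        refine (norm_add_le _ _).trans ?_
        rw [norm_mul, RCLike.norm_ofReal, RCLike.norm_ofReal]
        gcongr
        rw [RCLike.norm_I]
        split_ifs <;> norm_num
    _ < ε := by linarith [hP x hx, hQ x hx]

theorem memLp_restrict_of_continuousOn {X E : Type*} [TopologicalSpace X] [MeasurableSpace X]
    [OpensMeasurableSpace X] [NormedAddCommGroup E] {p : ENNReal} {μ : Measure X}
    [IsFiniteMeasureOnCompacts μ] {K : Set X} (hK : IsCompact K) (hKm : MeasurableSet K)
    {f : X → E} (hf : ContinuousOn f K) :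
    MemLp f p (μ.restrict K) := by
  have : IsFiniteMeasure (μ.restrict K) := isFiniteMeasure_restrict.2 hK.measure_lt_top.ne
  obtain ⟨C, hC⟩ := hK.exists_bound_of_continuousOn hf
  exact .of_bound (hf.aestronglyMeasurable_of_isCompact hK hKm) C
    ((ae_restrict_mem hKm).mono hC)

theorem norm_toLp_sub_toLp_le {X E : Type*} [MeasurableSpace X] [NormedAddCommGroup E]
    {p : ENNReal} {ν : Measure X} [IsFiniteMeasure ν] {f g : X → E}
    (hf : MemLp f p ν) (hg : MemLp g p ν) {ε : ℝ} (hε : 0 ≤ ε) (h : ∀ᵐ x ∂ν, ‖f x - g x‖ ≤ ε) :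
    ‖hf.toLp f - hg.toLp g‖ ≤ measureUnivNNReal ν ^ p.toReal⁻¹ * ε := by
  rw [← MemLp.toLp_sub]
  refine Lp.norm_le_of_ae_bound hε ?_
  filter_upwards [(hf.sub hg).coeFn_toLp, h] with x hx hfg
  rwa [hx]

variable {p : ENNReal} {μ : Measure ℝ} [IsLocallyFiniteMeasure μ]

theorem memLp_polynomial_eval (P : Polynomial 𝕜) :
    MemLp (fun x : ℝ => P.eval (x : 𝕜)) p (μ.restrict (Icc a b)) :=
  memLp_restrict_of_continuousOn isCompact_Icc measurableSet_Icc
    (P.continuous.comp RCLike.continuous_ofReal).continuousOn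

theorem memLp_ofReal_pow (n : ℕ) :
    MemLp (fun x : ℝ => (x : 𝕜) ^ n) p (μ.restrict (Icc a b)) :=
  memLp_restrict_of_continuousOn isCompact_Icc measurableSet_Icc
    (RCLike.continuous_ofReal.pow n).continuousOn

theorem toLp_polynomial_eval_mem_span (P : Polynomial 𝕜) :
    (memLp_polynomial_eval P).toLp _ ∈ Submodule.span 𝕜
      (range fun n : ℕ => ((memLp_ofReal_pow n).toLp _ : Lp 𝕜 p (μ.restrict (Icc a b)))) := by
  induction P using Polynomial.induction_on' with
  | add P Q hP hQ =>
    convert Submodule.add_mem _ hP hQ using 1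
    rw [← MemLp.toLp_add]
    congr 1
    ext x
    exact Polynomial.eval_add
  | monomial n r =>
    convert Submodule.smul_mem _ r (Submodule.subset_span (mem_range_self n)) using 1
    rw [← MemLp.toLp_const_smul]
    congr 1
    ext x
    exact Polynomial.eval_monomial

theorem dense_span_toLp_ofReal_pow [Fact (1 ≤ p)] (hp : p ≠ ⊤) :
    Dense (Submodule.span 𝕜
      (range fun n : ℕ => ((memLp_ofReal_pow n).toLp _ : Lp 𝕜 p (μ.restrict (Icc a b)))) :
        Set (Lp 𝕜 p (μ.restrict (Icc a b)))) := by
  have : IsFiniteMeasure (μ.restrict (Icc a b)) :=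
    isFiniteMeasure_restrict.2 isCompact_Icc.measure_lt_top.ne
  set K : ℝ := measureUnivNNReal (μ.restrict (Icc a b)) ^ p.toReal⁻¹
  have hK : 0 < K + 1 := by positivity
  rw [← dense_closure]
  refine (BoundedContinuousFunction.toLp_denseRange 𝕜 _ 𝕜 hp).mono ?_
  rintro _ ⟨f, rfl⟩
  have hf : MemLp f p (μ.restrict (Icc a b)) :=
    memLp_restrict_of_continuousOn isCompact_Icc measurableSet_Icc f.continuous.continuousOn
  refine Metric.mem_closure_iff.2 fun ε hε => ?_
  obtain ⟨P, hP⟩ :=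
    exists_rclike_polynomial_near_of_continuousOn f.continuous.continuousOn (div_pos hε hK)
  refine ⟨_, toLp_polynomial_eval_mem_span P, ?_⟩
  rw [dist_comm, dist_eq_norm]
  calc ‖(memLp_polynomial_eval P).toLp _ - hf.toLp f‖
      ≤ K * (ε / (K + 1)) := norm_toLp_sub_toLp_le _ hf (div_pos hε hK).le <|
        (ae_restrict_mem measurableSet_Icc).mono fun x hx => (hP x hx).le
    _ < (K + 1) * (ε / (K + 1)) := by gcongr; exact lt_add_one K
    _ = ε := mul_div_cancel₀ ε hK.ne'

end PolynomialDensity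

section HalfPlane

theorem mem_halfPlane_iff {s : ℂ} : s ∈ halfPlane ↔ 0 < 1 + 2 * s.re := by
  change -(1 / 2 : ℝ) < s.re ↔ _
  constructor <;> intro h <;> linarith

theorem zero_mem_halfPlane : (0 : ℂ) ∈ halfPlane :=
  mem_halfPlane_iff.2 (by norm_num)

theorem natCast_mem_halfPlane (n : ℕ) : (n : ℂ) ∈ halfPlane :=
  mem_halfPlane_iff.2 (by rw [Complex.natCast_re]; positivity)

theorem one_add_conj_add_self (b : ℂ) : 1 + conj b + b = ((1 + 2 * b.re : ℝ) : ℂ) := by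
  rw [add_assoc, add_comm (conj b), Complex.add_conj]
  push_cast
  rfl

theorem one_add_conj_add_ne_zero {s t : ℂ} (hs : s ∈ halfPlane) (ht : t ∈ halfPlane) :
    1 + conj s + t ≠ 0 := by
  intro h
  have hre : 1 + s.re + t.re = 0 := by simpa using congrArg Complex.re h
  linarith [mem_halfPlane_iff.1 hs, mem_halfPlane_iff.1 ht]

theorem one_add_ne_zero_of_mem_halfPlane {s : ℂ} (hs : s ∈ halfPlane) : 1 + s ≠ 0 := by
  simpa only [map_zero, add_zero] using one_add_conj_add_ne_zero zero_mem_halfPlane hs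

end HalfPlane

section Monomials

theorem mem_halfPlane_of_memLp {s : ℂ} (h : MemLp (monomialFun s) 2 unitIntervalMeasure) :
    s ∈ halfPlane := by
  have hsq : IntegrableOn (fun x => ‖monomialFun s x‖ ^ 2) (Ioo 0 1) :=
    IntegrableOn.mono_set ((memLp_two_iff_integrable_sq_norm h.1).1 h) Ioo_subset_Icc_self
  have hrpow : IntegrableOn (fun x : ℝ => x ^ (2 * s.re)) (Ioo 0 1) :=
    hsq.congr_fun (fun x hx => by
      simp only [monomialFun]
      rw [Complex.norm_cpow_eq_rpow_re_of_pos hx.1, mul_comm 2,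
        ← Real.rpow_mul_natCast hx.1.le, Nat.cast_ofNat]) measurableSet_Ioo
  rw [intervalIntegral.integrableOn_Ioo_rpow_iff zero_lt_one] at hrpow
  exact mem_halfPlane_iff.2 (by linarith)

theorem monomialFun_conj_add {x : ℝ} (hx : 0 < x) (s t : ℂ) :
    monomialFun (conj s + t) x = conj (monomialFun s x) * monomialFun t x := by
  have harg : (x : ℂ).arg ≠ Real.pi := by
    rw [Complex.arg_ofReal_of_nonneg hx.le]
    exact Real.pi_pos.ne
  simp only [monomialFun]
  rw [Complex.cpow_add _ _ (Complex.ofReal_ne_zero.2 hx.ne'), Complex.cpow_conj _ _ harg,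
    Complex.conj_ofReal]

theorem integral_monomialFun {s : ℂ} (hs : -1 < s.re) :
    ∫ x, monomialFun s x ∂unitIntervalMeasure = (1 + s)⁻¹ := by
  have hne : s + 1 ≠ 0 := fun h => by
    have hre : s.re + 1 = 0 := by simpa using congrArg Complex.re h
    linarith
  rw [integral_Icc_eq_integral_Ioc, ← intervalIntegral.integral_of_le zero_le_one]
  simp only [monomialFun]
  rw [integral_cpow (Or.inl hs), Complex.ofReal_one, Complex.one_cpow, Complex.ofReal_zero,
    Complex.zero_cpow hne, sub_zero, one_div, add_comm]

theorem ae_unitIntervalMeasure_pos : ∀ᵐ x ∂unitIntervalMeasure, 0 < x := by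
  rw [unitIntervalMeasure, ← Measure.restrict_congr_set Ioc_ae_eq_Icc]
  exact (ae_restrict_mem measurableSet_Ioc).mono fun x hx => hx.1

theorem coeFn_monomialL2 {s : ℂ} (hs : s ∈ halfPlane) :
    monomialL2 s hs =ᵐ[unitIntervalMeasure] monomialFun s :=
  MemLp.coeFn_toLp _

theorem inner_monomialL2 {s t : ℂ} (hs : s ∈ halfPlane) (ht : t ∈ halfPlane) :
    inner ℂ (monomialL2 s hs) (monomialL2 t ht) = (1 + conj s + t)⁻¹ := by
  have hre : -1 < (conj s + t).re := by
    rw [Complex.add_re, Complex.conj_re]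
    linarith [mem_halfPlane_iff.1 hs, mem_halfPlane_iff.1 ht]
  rw [L2.inner_def, add_assoc, ← integral_monomialFun hre]
  refine integral_congr_ae ?_
  filter_upwards [coeFn_monomialL2 hs, coeFn_monomialL2 ht, ae_unitIntervalMeasure_pos]
    with x hxs hxt hx
  rw [hxs, hxt, RCLike.inner_apply, monomialFun_conj_add hx, mul_comm]

theorem monomialL2_ne_zero {s : ℂ} (hs : s ∈ halfPlane) : monomialL2 s hs ≠ 0 := by
  rw [← inner_self_ne_zero (𝕜 := ℂ), inner_monomialL2]
  exact inv_ne_zero (one_add_conj_add_ne_zero hs hs)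

theorem dense_span_monomialL2 :
    Dense (Submodule.span ℂ (range fun s : halfPlane => monomialL2 s s.2) : Set L2Unit) := by
  refine (dense_span_toLp_ofReal_pow (𝕜 := ℂ) (p := 2) (μ := volume) (a := 0) (b := 1)
    ENNReal.ofNat_ne_top).mono
    (Submodule.span_mono ?_)
  rintro _ ⟨n, rfl⟩
  refine ⟨⟨n, natCast_mem_halfPlane n⟩, ?_⟩
  simp only [monomialL2]
  congr 1
  ext x
  exact Complex.cpow_natCast _ n

theorem dense_span_smul_monomialL2 {c β : ℂ → ℂ} (hc : ∀ s ∈ halfPlane, c s ≠ 0)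
    (hm : MapsTo β halfPlane halfPlane) (hβ : SurjOn β halfPlane halfPlane) :
    Dense (Submodule.span ℂ
      (range fun s : halfPlane => c s • monomialL2 (β s) (hm s.2)) : Set L2Unit) := by
  refine dense_span_monomialL2.mono (Submodule.span_le.2 ?_)
  rintro _ ⟨⟨_, ht⟩, rfl⟩
  obtain ⟨s, hs, rfl⟩ := hβ ht
  exact (Submodule.smul_mem_iff _ (hc s hs)).1 (Submodule.subset_span ⟨⟨s, hs⟩, rfl⟩)

end Monomials

section HalfPlaneToDisc

/-- The Möbius map of the half-plane onto the unit disc that vanishes at `b`. Its pole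
`-(1 + conj b)` is the reflection of `b` in the boundary line. -/
noncomputable def halfPlaneToDisc (b s : ℂ) : ℂ := (s - b) / (1 + conj b + s)

/-- The inverse of `halfPlaneToDisc b`, as a map from the unit disc to the half-plane. -/
noncomputable def discToHalfPlane (b z : ℂ) : ℂ := (b + (1 + conj b) * z) / (1 - z)

theorem halfPlaneToDisc_self (b : ℂ) : halfPlaneToDisc b b = 0 := by
  rw [halfPlaneToDisc, sub_self, zero_div]

theorem discToHalfPlane_zero (b : ℂ) : discToHalfPlane b 0 = b := by
  rw [discToHalfPlane, mul_zero, add_zero, sub_zero, div_one]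

theorem one_sub_ne_zero_of_mem_ball {z : ℂ} (hz : z ∈ Metric.ball (0 : ℂ) 1) : 1 - z ≠ 0 := by
  rw [sub_ne_zero]
  rintro rfl
  exact absurd (mem_ball_zero_iff.1 hz) (by rw [norm_one]; exact lt_irrefl 1)

variable {b s t z : ℂ}

theorem norm_sub_lt_norm_one_add_conj_add_iff (hb : b ∈ halfPlane) :
    ‖s - b‖ < ‖1 + conj b + s‖ ↔ s ∈ halfPlane := by
  have hsq : ‖1 + conj b + s‖ ^ 2 - ‖s - b‖ ^ 2 = (1 + 2 * b.re) * (1 + 2 * s.re) := by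
    simp only [← Complex.normSq_eq_norm_sq, Complex.normSq_apply, Complex.add_re, Complex.add_im,
      Complex.sub_re, Complex.sub_im, Complex.one_re, Complex.one_im, Complex.conj_re,
      Complex.conj_im]
    ring
  rw [mem_halfPlane_iff, ← mul_pos_iff_of_pos_left (mem_halfPlane_iff.1 hb), ← hsq, sub_pos,
    sq_lt_sq₀ (norm_nonneg _) (norm_nonneg _)]

theorem discToHalfPlane_sub (hz : 1 - z ≠ 0) :
    discToHalfPlane b z - b = z * (1 + conj b + discToHalfPlane b z) := by
  rw [discToHalfPlane]
  field_simp
  ring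

theorem one_add_conj_add_discToHalfPlane (hz : 1 - z ≠ 0) :
    1 + conj b + discToHalfPlane b z = (1 + conj b + b) / (1 - z) := by
  rw [discToHalfPlane]
  field_simp
  ring

theorem mapsTo_halfPlaneToDisc (hb : b ∈ halfPlane) :
    MapsTo (halfPlaneToDisc b) halfPlane (Metric.ball 0 1) := fun s hs => by
  rw [mem_ball_zero_iff, halfPlaneToDisc, norm_div,
    div_lt_one (norm_pos_iff.2 (one_add_conj_add_ne_zero hb hs))]
  exact (norm_sub_lt_norm_one_add_conj_add_iff hb).2 hs

theorem mapsTo_discToHalfPlane (hb : b ∈ halfPlane) :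
    MapsTo (discToHalfPlane b) (Metric.ball 0 1) halfPlane := fun z hz => by
  have hz1 := one_sub_ne_zero_of_mem_ball hz
  have hne : 1 + conj b + discToHalfPlane b z ≠ 0 := by
    rw [one_add_conj_add_discToHalfPlane hz1]
    exact div_ne_zero (one_add_conj_add_ne_zero hb hb) hz1
  rw [← norm_sub_lt_norm_one_add_conj_add_iff hb, discToHalfPlane_sub hz1, norm_mul]
  exact mul_lt_of_lt_one_left (norm_pos_iff.2 hne) (mem_ball_zero_iff.1 hz)

theorem invOn_discToHalfPlane_halfPlaneToDisc (hb : b ∈ halfPlane) :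
    InvOn (discToHalfPlane b) (halfPlaneToDisc b) halfPlane (Metric.ball 0 1) := by
  refine ⟨fun s hs => ?_, fun z hz => ?_⟩
  · have hz := one_sub_ne_zero_of_mem_ball (mapsTo_halfPlaneToDisc hb hs)
    have hne := one_add_conj_add_ne_zero hb hs
    rw [discToHalfPlane, div_eq_iff hz, halfPlaneToDisc]
    field_simp
    ring
  · rw [halfPlaneToDisc, discToHalfPlane_sub (one_sub_ne_zero_of_mem_ball hz),
      mul_div_cancel_right₀ _ (one_add_conj_add_ne_zero hb (mapsTo_discToHalfPlane hb hz))]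

theorem differentiableOn_halfPlaneToDisc (hb : b ∈ halfPlane) :
    DifferentiableOn ℂ (halfPlaneToDisc b) halfPlane :=
  (differentiableOn_id.sub_const b).div (differentiableOn_id.const_add _)
    fun _ hs => one_add_conj_add_ne_zero hb hs

theorem differentiableOn_discToHalfPlane (b : ℂ) :
    DifferentiableOn ℂ (discToHalfPlane b) (Metric.ball 0 1) :=
  ((differentiableOn_id.const_mul _).const_add b).div (differentiableOn_id.const_sub 1)
    fun _ hz => one_sub_ne_zero_of_mem_ball hz

theorem conj_mul_mul_one_sub_conj_halfPlaneToDisc_mul (hb : b ∈ halfPlane) (hs : s ∈ halfPlane)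
    (ht : t ∈ halfPlane) :
    conj (1 + conj b + s) * (1 + conj b + t) *
        (1 - conj (halfPlaneToDisc b s) * halfPlaneToDisc b t) =
      (1 + conj b + b) * (1 + conj s + t) := by
  have hne : conj (1 + conj b + s) ≠ 0 := (map_ne_zero _).2 (one_add_conj_add_ne_zero hb hs)
  have hne' : 1 + conj b + t ≠ 0 := one_add_conj_add_ne_zero hb ht
  rw [halfPlaneToDisc, halfPlaneToDisc, map_div₀, div_mul_div_comm, mul_one_sub,
    mul_div_cancel₀ _ (mul_ne_zero hne hne')]
  simp only [map_add, map_sub, map_one, Complex.conj_conj]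
  ring

end HalfPlaneToDisc

section Automorphisms

theorem exists_norm_eq_one_eqOn_smul_of_leftInvOn_ball {E : Type*} [NormedAddCommGroup E]
    [NormedSpace ℂ E] [StrictConvexSpace ℝ E] {R : ℝ} (hR : 0 < R) {f : ℂ → E} {g : E → ℂ}
    (hf : DifferentiableOn ℂ f (Metric.ball 0 R)) (hg : DifferentiableOn ℂ g (Metric.ball 0 R))
    (hfm : MapsTo f (Metric.ball 0 R) (Metric.ball 0 R))
    (hgm : MapsTo g (Metric.ball 0 R) (Metric.ball 0 R))
    (hgf : LeftInvOn g f (Metric.ball 0 R)) (hf0 : f 0 = 0) :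
    ∃ l : E, ‖l‖ = 1 ∧ EqOn f (fun z => z • l) (Metric.ball 0 R) := by
  have hfm' := hfm.mono_right Metric.ball_subset_closedBall
  have hgm' := hgm.mono_right Metric.ball_subset_closedBall
  have hg0 : g 0 = 0 := hf0 ▸ hgf (Metric.mem_ball_self hR)
  have hnorm : ∀ z ∈ Metric.ball (0 : ℂ) R, ‖f z‖ = ‖z‖ := fun z hz => by
    refine (Complex.norm_le_norm_of_mapsTo_ball hf hfm' hf0 (mem_ball_zero_iff.1 hz)).antisymm ?_
    simpa only [hgf hz] using
      Complex.norm_le_norm_of_mapsTo_ball hg hgm' hg0 (mem_ball_zero_iff.1 (hfm hz))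
  obtain ⟨w, hw0, hwR⟩ := NormedField.exists_norm_lt ℂ hR
  have hw : w ∈ Metric.ball (0 : ℂ) R := mem_ball_zero_iff.2 hwR
  have hslope : ‖dslope f 0 w‖ = R / R := by
    rw [dslope_of_ne _ (norm_pos_iff.1 hw0), slope_def_module, hf0, sub_zero, sub_zero, norm_smul,
      norm_inv, hnorm w hw, inv_mul_cancel₀ hw0.ne', div_self hR.ne']
  obtain ⟨l, hl, hfl⟩ := Complex.affine_of_mapsTo_ball_of_exists_norm_dslope_eq_div' hf
    (by rwa [hf0]) ⟨w, hw, hslope⟩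
  refine ⟨l, hl.trans (div_self hR.ne'), fun z hz => ?_⟩
  simpa only [hf0, zero_add, sub_zero] using hfl hz

theorem mapsTo_mul_left_ball {l : ℂ} (hl : ‖l‖ = 1) (R : ℝ) :
    MapsTo (fun z => l * z) (Metric.ball 0 R) (Metric.ball 0 R) := fun z hz => by
  rwa [mem_ball_zero_iff, norm_mul, hl, one_mul, ← mem_ball_zero_iff]

variable {β : ℂ → ℂ}

theorem IsHalfPlaneAutomorphism.exists_halfPlaneToDisc_eq (hβ : IsHalfPlaneAutomorphism β) :
    ∃ l : ℂ, ‖l‖ = 1 ∧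
      ∀ s ∈ halfPlane, halfPlaneToDisc (β 0) (β s) = l * halfPlaneToDisc 0 s := by
  obtain ⟨hd, hm, γ, hγd, hγm, hγβ, -⟩ := hβ
  have h0 := zero_mem_halfPlane
  have hb := hm h0
  have hinv := invOn_discToHalfPlane_halfPlaneToDisc h0
  obtain ⟨l, hl, hrot⟩ := exists_norm_eq_one_eqOn_smul_of_leftInvOn_ball one_pos
    (f := halfPlaneToDisc (β 0) ∘ β ∘ discToHalfPlane 0)
    (g := halfPlaneToDisc 0 ∘ γ ∘ discToHalfPlane (β 0))
    ((differentiableOn_halfPlaneToDisc hb).comp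
      (hd.comp (differentiableOn_discToHalfPlane 0) (mapsTo_discToHalfPlane h0))
      (hm.comp (mapsTo_discToHalfPlane h0)))
    ((differentiableOn_halfPlaneToDisc h0).comp
      (hγd.comp (differentiableOn_discToHalfPlane _) (mapsTo_discToHalfPlane hb))
      (hγm.comp (mapsTo_discToHalfPlane hb)))
    ((mapsTo_halfPlaneToDisc hb).comp (hm.comp (mapsTo_discToHalfPlane h0)))
    ((mapsTo_halfPlaneToDisc h0).comp (hγm.comp (mapsTo_discToHalfPlane hb)))
    (fun z hz => by
      have hw := mapsTo_discToHalfPlane h0 hz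
      simp only [Function.comp_apply]
      rw [(invOn_discToHalfPlane_halfPlaneToDisc hb).1 (hm hw), hγβ hw, hinv.2 hz])
    (by simp only [Function.comp_apply, discToHalfPlane_zero, halfPlaneToDisc_self])
  refine ⟨l, hl, fun s hs => ?_⟩
  simpa only [Function.comp_apply, hinv.1 hs, smul_eq_mul, mul_comm] using
    hrot (mapsTo_halfPlaneToDisc h0 hs)

theorem isHalfPlaneAutomorphism_of_halfPlaneToDisc_eq (hm : MapsTo β halfPlane halfPlane) {l : ℂ}
    (hl : ‖l‖ = 1)
    (h : ∀ s ∈ halfPlane, halfPlaneToDisc (β 0) (β s) = l * halfPlaneToDisc 0 s) :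
    IsHalfPlaneAutomorphism β := by
  have h0 := zero_mem_halfPlane
  have hb := hm h0
  have hl0 : l ≠ 0 := norm_ne_zero_iff.1 (hl ▸ one_ne_zero)
  have hl' : ‖l⁻¹‖ = 1 := by rw [norm_inv, hl, inv_one]
  have hinv0 := invOn_discToHalfPlane_halfPlaneToDisc h0
  have hinvb := invOn_discToHalfPlane_halfPlaneToDisc hb
  have hrot := (mapsTo_mul_left_ball hl 1).comp (mapsTo_halfPlaneToDisc h0)
  have hrot' := (mapsTo_mul_left_ball hl' 1).comp (mapsTo_halfPlaneToDisc hb)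
  have hβ : ∀ s ∈ halfPlane, β s = discToHalfPlane (β 0) (l * halfPlaneToDisc 0 s) :=
    fun s hs => by rw [← h s hs, hinvb.1 (hm hs)]
  refine ⟨?_, hm, fun s => discToHalfPlane 0 (l⁻¹ * halfPlaneToDisc (β 0) s), ?_,
    (mapsTo_discToHalfPlane h0).comp hrot', fun s hs => ?_, fun s hs => ?_⟩
  · exact ((differentiableOn_discToHalfPlane _).comp
      ((differentiableOn_halfPlaneToDisc h0).const_mul l) hrot).congr hβ
  · exact (differentiableOn_discToHalfPlane 0).comp
      ((differentiableOn_halfPlaneToDisc hb).const_mul l⁻¹) hrot'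
  · beta_reduce
    rw [h s hs, inv_mul_cancel_left₀ hl0, hinv0.1 hs]
  · have hz : l⁻¹ * halfPlaneToDisc (β 0) s ∈ Metric.ball (0 : ℂ) 1 := hrot' hs
    beta_reduce
    rw [hβ _ (mapsTo_discToHalfPlane h0 hz), hinv0.2 hz, mul_inv_cancel_left₀ hl0, hinvb.1 hs]

theorem isHalfPlaneAutomorphism_iff (hm : MapsTo β halfPlane halfPlane) :
    IsHalfPlaneAutomorphism β ↔ ∀ s ∈ halfPlane, ∀ t ∈ halfPlane,
      conj (halfPlaneToDisc (β 0) (β s)) * halfPlaneToDisc (β 0) (β t) =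
        conj (halfPlaneToDisc 0 s) * halfPlaneToDisc 0 t :=
  Iff.trans ⟨IsHalfPlaneAutomorphism.exists_halfPlaneToDisc_eq,
    fun ⟨_, hl, h⟩ => isHalfPlaneAutomorphism_of_halfPlaneToDisc_eq hm hl h⟩
    exists_norm_eq_one_forall_eq_mul_iff

end Automorphisms

section GramMatrix

variable {c β : ℂ → ℂ}

/-- The functions `c s • x ^ β s` have the same Gram matrix as the monomials `x ^ s`, where the
monomials have Gram matrix `(1 + conj s + t)⁻¹`. The denominators are cleared. -/
def PreservesGram (c β : ℂ → ℂ) : Prop :=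
  ∀ s ∈ halfPlane, ∀ t ∈ halfPlane,
    conj (c s) * c t * (1 + conj s + t) = 1 + conj (β s) + β t

theorem PreservesGram.ne_zero (h : PreservesGram c β) (hm : MapsTo β halfPlane halfPlane) {s : ℂ}
    (hs : s ∈ halfPlane) : c s ≠ 0 := fun hc =>
  one_add_conj_add_ne_zero (hm hs) (hm hs) (by rw [← h s hs s hs, hc, mul_zero, zero_mul])

theorem isUnitaryMultiplier_iff (hb : β 0 ∈ halfPlane) :
    IsUnitaryMultiplier c β ↔ ∀ s ∈ halfPlane, ∀ t ∈ halfPlane,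
      (1 + conj (β 0) + β 0) * (conj (c s) * c t) * (conj (1 + s) * (1 + t)) =
        conj (1 + conj (β 0) + β s) * (1 + conj (β 0) + β t) := by
  set r : ℂ := (Real.sqrt (1 + 2 * (β 0).re) : ℂ) with hr
  have hrr : r * r = 1 + conj (β 0) + β 0 := by
    rw [one_add_conj_add_self, hr, ← Complex.ofReal_mul,
      Real.mul_self_sqrt (mem_halfPlane_iff.1 hb).le]
  have hr0 : r ≠ 0 := fun h => one_add_conj_add_ne_zero hb hb (by rw [← hrr, h, mul_zero])
  have hunimodular : IsUnitaryMultiplier c β ↔ ∃ l : ℂ, ‖l‖ = 1 ∧ ∀ s ∈ halfPlane,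
      c s = l * ((1 + conj (β 0) + β s) / (r * (1 + s))) := by
    simp only [Complex.norm_eq_one_iff, exists_exists_eq_and, IsUnitaryMultiplier, div_mul_div_comm,
      mul_div_assoc, hr]
  rw [hunimodular, exists_norm_eq_one_forall_eq_mul_iff]
  refine forall₂_congr fun s hs => forall₂_congr fun t ht => ?_
  have hs1 : conj (1 + s) ≠ 0 := (map_ne_zero _).2 (one_add_ne_zero_of_mem_halfPlane hs)
  have ht1 := one_add_ne_zero_of_mem_halfPlane ht
  rw [map_div₀, map_mul, hr, Complex.conj_ofReal, ← hr, div_mul_div_comm,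
    eq_div_iff (mul_ne_zero (mul_ne_zero hr0 hs1) (mul_ne_zero hr0 ht1)), ← hrr]
  refine Eq.congr_left ?_
  ring

theorem PreservesGram.isUnitaryMultiplier (h : PreservesGram c β) (hb : β 0 ∈ halfPlane) :
    IsUnitaryMultiplier c β := by
  refine (isUnitaryMultiplier_iff hb).2 fun s hs t ht => ?_
  have hrow : ∀ t ∈ halfPlane, conj (c 0) * c t * (1 + t) = 1 + conj (β 0) + β t := fun t ht => by
    simpa only [map_zero, add_zero] using h 0 zero_mem_halfPlane t ht
  rw [← hrow s hs, ← hrow t ht, ← hrow 0 zero_mem_halfPlane]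
  simp only [map_mul, Complex.conj_conj]
  ring

theorem IsUnitaryMultiplier.preservesGram_iff (h : IsUnitaryMultiplier c β)
    (hm : MapsTo β halfPlane halfPlane) :
    PreservesGram c β ↔ IsHalfPlaneAutomorphism β := by
  have h0 := zero_mem_halfPlane
  have hb := hm h0
  rw [isHalfPlaneAutomorphism_iff hm]
  refine forall₂_congr fun s hs => forall₂_congr fun t ht => ?_
  have hc := (isUnitaryMultiplier_iff hb).1 h s hs t ht
  have hkernel := conj_mul_mul_one_sub_conj_halfPlaneToDisc_mul hb (hm hs) (hm ht)
  have hkernel0 := conj_mul_mul_one_sub_conj_halfPlaneToDisc_mul h0 hs ht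
  simp only [map_zero, add_zero, one_mul] at hkernel0
  have hne : conj (1 + conj (β 0) + β s) * (1 + conj (β 0) + β t) ≠ 0 :=
    mul_ne_zero ((map_ne_zero _).2 (one_add_conj_add_ne_zero hb (hm hs)))
      (one_add_conj_add_ne_zero hb (hm ht))
  have hleft : (1 + conj (β 0) + β 0) * (conj (c s) * c t * (1 + conj s + t)) =
      conj (1 + conj (β 0) + β s) * (1 + conj (β 0) + β t) *
        (1 - conj (halfPlaneToDisc 0 s) * halfPlaneToDisc 0 t) := by
    rw [← hkernel0, ← hc]
    ring
  rw [← mul_right_inj' (one_add_conj_add_ne_zero hb hb), hleft, ← hkernel, mul_right_inj' hne,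
    sub_right_inj, eq_comm]

theorem preservesGram_iff (hm : MapsTo β halfPlane halfPlane) :
    PreservesGram c β ↔ IsHalfPlaneAutomorphism β ∧ IsUnitaryMultiplier c β :=
  ⟨fun h => have hc := h.isUnitaryMultiplier (hm zero_mem_halfPlane)
    ⟨(hc.preservesGram_iff hm).1 h, hc⟩, fun h => (h.2.preservesGram_iff hm).2 h.1⟩

end GramMatrix

section Operators

variable {T : L2Unit →L[ℂ] L2Unit} {c β : ℂ → ℂ}

theorem inner_smul_monomialL2_eq_iff (hm : MapsTo β halfPlane halfPlane) {s t : ℂ}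
    (hs : s ∈ halfPlane) (ht : t ∈ halfPlane) :
    inner ℂ (c s • monomialL2 (β s) (hm hs)) (c t • monomialL2 (β t) (hm ht)) =
        inner ℂ (monomialL2 s hs) (monomialL2 t ht) ↔
      conj (c s) * c t * (1 + conj s + t) = 1 + conj (β s) + β t := by
  rw [inner_smul_left, inner_smul_right, inner_monomialL2, inner_monomialL2, ← mul_assoc,
    ← div_eq_mul_inv, ← one_div, div_eq_div_iff (one_add_conj_add_ne_zero (hm hs) (hm ht))
      (one_add_conj_add_ne_zero hs ht), one_mul]

theorem actsOnMonomials_iff (hm : MapsTo β halfPlane halfPlane) :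
    ActsOnMonomials T c β ↔ ∀ (s : ℂ) (hs : s ∈ halfPlane),
      T (monomialL2 s hs) = c s • monomialL2 (β s) (hm hs) := by
  refine forall₂_congr fun s hs => ?_
  have hsmul : ((c s • monomialL2 (β s) (hm hs) : L2Unit) : ℝ → ℂ) =ᵐ[unitIntervalMeasure]
      fun x => c s * monomialFun (β s) x := by
    filter_upwards [Lp.coeFn_smul (c s) (monomialL2 (β s) (hm hs)), coeFn_monomialL2 (hm hs)]
      with x hx hβx
    rw [hx, Pi.smul_apply, hβx, smul_eq_mul]
  exact ⟨fun h => Lp.ext (h.trans hsmul.symm), fun h => by rwa [h]⟩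

theorem ActsOnMonomials.mapsTo (h : ActsOnMonomials T c β) (hT : Function.Injective T) :
    MapsTo β halfPlane halfPlane := fun s hs => by
  have hc : c s ≠ 0 := fun hc => by
    refine monomialL2_ne_zero hs ((map_eq_zero_iff T hT).1 (Lp.ext ?_))
    filter_upwards [h s hs, Lp.coeFn_zero ℂ 2 unitIntervalMeasure] with x hx hx0
    rw [hx, hx0, hc, zero_mul, Pi.zero_apply]
  have hmem := ((memLp_congr_ae (h s hs)).1 (Lp.memLp _)).const_mul (c s)⁻¹
  simp only [inv_mul_cancel_left₀ hc] at hmem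
  exact mem_halfPlane_of_memLp hmem

theorem ActsOnMonomials.unique {S : L2Unit →L[ℂ] L2Unit} (hS : ActsOnMonomials S c β)
    (hT : ActsOnMonomials T c β) : S = T := by
  refine ContinuousLinearMap.ext_on dense_span_monomialL2 ?_
  rintro _ ⟨s, rfl⟩
  exact Lp.ext ((hS s s.2).trans (hT s s.2).symm)

theorem ActsOnMonomials.automorphism_and_multiplier_of_isometry (h : ActsOnMonomials T c β)
    (hT : Isometry T) : IsHalfPlaneAutomorphism β ∧ IsUnitaryMultiplier c β := by
  have hm := h.mapsTo hT.injective
  have hinner : ∀ f g, inner ℂ (T f) (T g) = inner ℂ f g :=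
    (LinearMap.norm_map_iff_inner_map_map T).1 ((AddMonoidHomClass.isometry_iff_norm T).1 hT)
  refine (preservesGram_iff hm).1 fun s hs t ht => (inner_smul_monomialL2_eq_iff hm hs ht).1 ?_
  rw [← (actsOnMonomials_iff hm).1 h, ← (actsOnMonomials_iff hm).1 h, hinner]

theorem exists_unitary_actsOnMonomials (hβ : IsHalfPlaneAutomorphism β)
    (hc : IsUnitaryMultiplier c β) :
    ∃ T : L2Unit →L[ℂ] L2Unit, ActsOnMonomials T c β ∧ T ∈ unitary (L2Unit →L[ℂ] L2Unit) := by
  obtain ⟨-, hm, γ, -, hγm, hγ⟩ := id hβ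
  have hgram := (preservesGram_iff hm).2 ⟨hβ, hc⟩
  obtain ⟨e, he⟩ := exists_linearIsometryEquiv_of_inner_eq dense_span_monomialL2
    (dense_span_smul_monomialL2 (fun s => hgram.ne_zero hm) hm (hγ.2.surjOn hγm))
    fun s t => (inner_smul_monomialL2_eq_iff hm s.2 t.2).2 (hgram s s.2 t t.2)
  exact ⟨_, (actsOnMonomials_iff hm).2 fun s hs => he ⟨s, hs⟩,
    (Unitary.linearIsometryEquiv.symm e).2⟩

end Operators

theorem mainTheorem5_general (c β : ℂ → ℂ) :
    (IsHalfPlaneAutomorphism β ∧ IsUnitaryMultiplier c β →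
      ∃ T : L2Unit →L[ℂ] L2Unit, ActsOnMonomials T c β ∧ T ∈ unitary (L2Unit →L[ℂ] L2Unit)) ∧
    ∀ T : L2Unit →L[ℂ] L2Unit, ActsOnMonomials T c β →
      [Isometry T, T ∈ unitary (L2Unit →L[ℂ] L2Unit),
        IsHalfPlaneAutomorphism β ∧ IsUnitaryMultiplier c β].TFAE := by
  have hex := fun h : IsHalfPlaneAutomorphism β ∧ IsUnitaryMultiplier c β =>
    exists_unitary_actsOnMonomials h.1 h.2
  refine ⟨hex, fun T hT => ?_⟩
  tfae_have 2 → 1 := fun hu => (AddMonoidHomClass.isometry_iff_norm T).2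
    (ContinuousLinearMap.norm_map_of_mem_unitary hu)
  tfae_have 1 → 3 := hT.automorphism_and_multiplier_of_isometry
  tfae_have 3 → 2 := fun h => by
    obtain ⟨S, hS, hSu⟩ := hex h
    exact hT.unique hS ▸ hSu
  tfae_finish

theorem mainTheorem5 (c β : ℂ → ℂ) :
    ((∃ T : L2Unit →L[ℂ] L2Unit,
        ActsOnMonomials T c β ∧ T ∈ unitary (L2Unit →L[ℂ] L2Unit)) ↔
      (IsHalfPlaneAutomorphism β ∧ IsUnitaryMultiplier c β)) ∧
    (∀ T : L2Unit →L[ℂ] L2Unit, ActsOnMonomials T c β →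
      (T ∈ unitary (L2Unit →L[ℂ] L2Unit) ↔
        (IsHalfPlaneAutomorphism β ∧ IsUnitaryMultiplier c β))) := by
  obtain ⟨hex, htfae⟩ := mainTheorem5_general c β
  exact ⟨⟨fun ⟨T, hT, hu⟩ => ((htfae T hT).out 1 2).1 hu, hex⟩, fun T hT => (htfae T hT).out 1 2⟩
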